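/- \textbf{Setting.} Consider a downlink with base stations (BSs) of $M$ antennas each and users partitioned into clusters $\mathcal U_1,\dots,\mathcal U_N$. All users of $\mathcal U_n$ are served by the BS $\bar l_n$ (different clusters may share a BS), $\bar n_k$ denotes the cluster of user $k$ and $b_k=\bar l_{\bar n_k}$ its serving BS. A bipartite graph $\mathcal E$ records which BS--user links exist, and $\mathcal B_k=\{n\ne\bar n_k:(k,\bar l_n)\in\mathcal E\}$. The channel from BS $l$ to user $k$ is $\mathbf h_{k,l}=\mathbf\Theta_{k,l}^{1/2}\mathbf h^w_{k,l}\in\mathbb C^M$, where the $\mathbf\Theta_{k,l}$ are positive semidefinite and the entries of all vectors $\mathbf h^w_{k,l}$ are i.i.d. $\mathcal{CN}(0,1)$. For every user, $\mathbf\Theta_{k,b_k}=L_k\mathbf\Theta^\circ_{\bar n_k}$ with a path loss $L_k>0$, where each $\mathbf\Theta_n^\circ$ is positive semidefinite with $\mathrm{Tr}(\mathbf\Theta_n^\circ)=M$; $\lambda_n$ is the largest eigenvalue of $\mathbf\Theta_n^\circ$. User $k$ has transmit power $P_k\ge 0$, weight $w_k>0$ and outage level $\epsilon_k\in(0,1)$,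 and $\bar P_n=\sum_{j\in\mathcal U_n}P_j$. For each $n$ let $|\mathcal U_n|\le S_n\le M$ and let $\mathbf F_n\in\mathbb C^{M\times S_n}$ satisfy $\mathbf F_n^\dagger\mathbf F_n=\mathbf I$. The inner precoder $\mathbf g_k$, $\|\mathbf g_k\|=1$, is the zero-forcing one: the normalized projection of $\mathbf F_{\bar n_k}^\dagger\mathbf h_{k,b_k}$ on the orthogonal complement of $\mathrm{span}\{\mathbf F_{\bar n_k}^\dagger\mathbf h_{j,b_k}:j\in\mathcal U_{\bar n_k}\setminus\{k\}\}$ (an arbitrary unit vector if the projection is $0$). Put $\hat I_k=\sum_{n\in\mathcal B_k}\bar P_n\mathrm{Tr}(\mathbf F_n^\dagger\mathbf\Theta_{k,\bar l_n}\mathbf F_n)$, $\delta_k=\ln(1/\epsilon_k)$, $\sigma_k=\tfrac12\big(\sqrt{2\delta_k}+\sqrt{2\delta_k+4}\big)$, $\bar{\mathbf\Theta}^\circ_{\bar n_k}=\mathbf\Theta^\circ_{\bar n_k}/\lambda_{\bar n_k}$ and $$\bar{\mathbf\Theta}_{k,n}=\frac{w_k\bar P_n}{L_k\lambda_{\bar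 n_k}P_k}\mathbf\Theta_{k,\bar l_n},\qquad c_k(\gamma)=\frac{w_k\gamma}{L_k\lambda_{\bar n_k}P_k}+\Big(1-\frac{\sqrt{2\delta_k}}{\sigma_k}\Big)\big(|\mathcal U_{\bar n_k}|-1\big).$$ \textbf{Theorem.} Let $k$ be a user with $P_k>0$ and let $\gamma\in\mathbb R$. If $$\Big(1-\frac{\sqrt{2\delta_k}}{\sigma_k}\Big)\mathrm{Tr}\big(\bar{\mathbf\Theta}^\circ_{\bar n_k}\mathbf F_{\bar n_k}\mathbf F_{\bar n_k}^\dagger\big)\ \ge\ \gamma\sum_{n\in\mathcal B_k}\mathrm{Tr}\big(\bar{\mathbf\Theta}_{k,n}\mathbf F_n\mathbf F_n^\dagger\big)+c_k(\gamma)$$ and $$\mathrm{Tr}\big(\bar{\mathbf\Theta}^\circ_{\bar n_k}\mathbf F_{\bar n_k}\mathbf F_{\bar n_k}^\dagger\big)\ \ge\ \sigma_k^2+|\mathcal U_{\bar n_k}|-1,$$ then $$\Pr\Big\{\big|\mathbf h_{k,b_k}^\dagger\mathbf F_{\bar n_k}\mathbf g_k\big|^2\ge\frac{w_k\gamma}{P_k}\big(\hat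 I_k+1\big)\Big\}\ \ge\ 1-\epsilon_k .$$ Moreover, if $L_k\ge 1$ (in particular if the direct link is normalized to $L_k=1$), the same holds with the factor $L_k$ omitted from $\bar{\mathbf\Theta}_{k,n}$ and $c_k(\gamma)$. -/

import Mathlib

open scoped Matrix ComplexOrder

noncomputable section

namespace MassiveMIMO

open MeasureTheory ProbabilityTheory

/-- Largest eigenvalue of a Hermitian matrix. -/
def largestEigenvalue {M : ℕ} (A : Matrix (Fin M) (Fin M) ℂ) (hA : A.IsHermitian) : ℝ :=
  ⨆ i, hA.eigenvalues i

open scoped MatrixOrder in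
/-- The positive semidefinite square root `A ^ (1/2)` of a positive semidefinite matrix. -/
def psdSqrt {M : ℕ} (A : Matrix (Fin M) (Fin M) ℂ) : Matrix (Fin M) (Fin M) ℂ :=
  CFC.sqrt A

/-- The standard (circularly symmetric) complex Gaussian law `CN(0,1)`: independent real and
imaginary parts, each `N(0,1/2)`. -/
def stdComplexGaussian : Measure ℂ :=
  ((gaussianReal 0 (1 / 2)).prod (gaussianReal 0 (1 / 2))).map
    (fun p : ℝ × ℝ => (p.1 : ℂ) + (p.2 : ℂ) * Complex.I)

/-- A massive MIMO cellular downlink with `M` antennas per base station (BS), `K` users, `L` BSs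
and `N` user clusters. -/
structure CellularSystem (M K L N : ℕ) where
  /-- the index of the cluster that contains user `k` -/
  cluster : Fin K → Fin N
  /-- the BS serving (all users of) cluster `n` -/
  bs : Fin N → Fin L
  /-- the edges of the topology graph: `edge k l` iff there is a wireless link from BS `l` to
  user `k` -/
  edge : Fin K → Fin L → Prop
  /-- the spatial correlation matrix between BS `l` and user `k` -/
  corr : Fin K → Fin L → Matrix (Fin M) (Fin M) ℂ
  corr_psd : ∀ k l, (corr k l).PosSemidef
  /-- the normalized spatial correlation matrix of cluster `n` -/
  corr₀ : Fin N → Matrix (Fin M) (Fin M) ℂ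
  corr₀_psd : ∀ n, (corr₀ n).PosSemidef
  corr₀_trace : ∀ n, (corr₀ n).trace = (M : ℂ)
  /-- the path loss (power gain) between user `k` and its serving BS -/
  pathLoss : Fin K → ℝ
  pathLoss_pos : ∀ k, 0 < pathLoss k
  corr_serving : ∀ k, corr k (bs (cluster k)) = (pathLoss k : ℂ) • corr₀ (cluster k)
  /-- the transmit power allocated to user `k` -/
  power : Fin K → ℝ
  power_nonneg : ∀ k, 0 ≤ power k
  /-- the QoS weight of user `k` -/
  weight : Fin K → ℝ
  weight_pos : ∀ k, 0 < weight k
  /-- the maximum allowable outage probability of user `k` -/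
  outage : Fin K → ℝ
  outage_pos : ∀ k, 0 < outage k
  outage_lt_one : ∀ k, outage k < 1

namespace CellularSystem

variable {M K L N : ℕ} (sys : CellularSystem M K L N)

/-- The users of cluster `n`. -/
def users (n : Fin N) : Finset (Fin K) := Finset.univ.filter fun k => sys.cluster k = n

/-- The BS serving user `k`. -/
def servingBS (k : Fin K) : Fin L := sys.bs (sys.cluster k)

open Classical in
/-- The clusters that interfere with user `k`. -/
def interferers (k : Fin K) : Finset (Fin N) :=
  Finset.univ.filter fun n => n ≠ sys.cluster k ∧ sys.edge k (sys.bs n)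

/-- Sum transmit power of the users of cluster `n`. -/
def clusterPower (n : Fin N) : ℝ := ∑ k ∈ sys.users n, sys.power k

/-- Largest eigenvalue of the normalized correlation matrix of cluster `n`. -/
def lam (n : Fin N) : ℝ := largestEigenvalue (sys.corr₀ n) (sys.corr₀_psd n).isHermitian

/-- `δ_k = ln (1 / ε_k)`. -/
def delta (k : Fin K) : ℝ := Real.log (1 / sys.outage k)

/-- `σ_k = (√(2 δ_k) + √(2 δ_k + 4)) / 2`. -/
def sigma (k : Fin K) : ℝ :=
  (Real.sqrt (2 * sys.delta k) + Real.sqrt (2 * sys.delta k + 4)) / 2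

/-- The channel vector from BS `l` to user `k`, as a function of the white vectors `hw`. -/
def channel {Ω : Type*} (hw : Fin K → Fin L → Fin M → Ω → ℂ) (k : Fin K) (l : Fin L) (ω : Ω) :
    Fin M → ℂ :=
  psdSqrt (sys.corr k l) *ᵥ fun i => hw k l i ω

/-- Tx subspace control: for every cluster a dimension `S n` between the number of its users and
`M`, and a semi-unitary `M × S n` matrix. -/
structure SubspaceControl where
  S : Fin N → ℕ
  card_le_S : ∀ n, (sys.users n).card ≤ S n
  S_le : ∀ n, S n ≤ M
  F : (n : Fin N) → Matrix (Fin M) (Fin (S n)) ℂ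
  semiunitary : ∀ n, (F n)ᴴ * F n = 1

end CellularSystem

/-- The entries of all white channel vectors are i.i.d. standard complex Gaussian. -/
structure IsWhiteGaussian {M K L : ℕ} {Ω : Type*} [MeasurableSpace Ω] (μ : Measure Ω)
    (hw : Fin K → Fin L → Fin M → Ω → ℂ) : Prop where
  measurable : ∀ k l i, Measurable (hw k l i)
  law : ∀ k l i, μ.map (hw k l i) = stdComplexGaussian
  indep : iIndepFun (fun (a : Fin K × Fin L × Fin M) => hw a.1 a.2.1 a.2.2) μ

namespace CellularSystem.SubspaceControl

variable {M K L N : ℕ} {sys : CellularSystem M K L N} (ctl : sys.SubspaceControl)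

/-- The effective channel `F_n† h_{k, l_n}` of user `k` in cluster `n`. -/
def effChannel {Ω : Type*} (hw : Fin K → Fin L → Fin M → Ω → ℂ) (n : Fin N) (k : Fin K) (ω : Ω) :
    EuclideanSpace ℂ (Fin (ctl.S n)) :=
  WithLp.toLp 2 ((ctl.F n)ᴴ *ᵥ sys.channel hw k (sys.bs n) ω)

/-- Projection of the effective channel of user `k` on the orthogonal complement of the span of
the effective channels of the other users of its cluster. -/
def zfProjection {Ω : Type*} (hw : Fin K → Fin L → Fin M → Ω → ℂ) (k : Fin K) (ω : Ω) :
    EuclideanSpace ℂ (Fin (ctl.S (sys.cluster k))) :=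
  (Submodule.span ℂ ((fun j => ctl.effChannel hw (sys.cluster k) j ω) ''
      {j | sys.cluster j = sys.cluster k ∧ j ≠ k}))ᗮ.starProjection
    (ctl.effChannel hw (sys.cluster k) k ω)

/-- `g` is the zero-forcing inner precoding vector of user `k`: the normalized projection (an
arbitrary unit vector on the event that the projection vanishes). -/
structure IsZFPrecoder {Ω : Type*} [MeasurableSpace Ω] (hw : Fin K → Fin L → Fin M → Ω → ℂ)
    (k : Fin K) (g : Ω → EuclideanSpace ℂ (Fin (ctl.S (sys.cluster k)))) : Prop where
  measurable : Measurable g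
  norm_eq : ∀ ω, ‖g ω‖ = 1
  proj_eq : ∀ ω, ((‖ctl.zfProjection hw k ω‖ : ℝ) : ℂ) • g ω = ctl.zfProjection hw k ω

/-- The deterministic interference approximation
`Î_k = ∑_{n ∈ B_k} P̄_n Tr (F_n† Θ_{k, l_n} F_n)`. -/
def interferenceApprox (k : Fin K) : ℝ :=
  ∑ n ∈ sys.interferers k,
    sys.clusterPower n * ((ctl.F n)ᴴ * sys.corr k (sys.bs n) * ctl.F n).trace.re

/-- The approximate SINR chance constraint of user `k` with QoS level `γ`:
`Pr {|h_{k,b_k}† F g_k|² ≥ (w_k γ / P_k) (Î_k + 1)} ≥ 1 - ε_k`. -/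
def ChanceConstraint {Ω : Type*} [MeasurableSpace Ω] (μ : Measure Ω)
    (hw : Fin K → Fin L → Fin M → Ω → ℂ) (k : Fin K)
    (g : Ω → EuclideanSpace ℂ (Fin (ctl.S (sys.cluster k)))) (γ : ℝ) : Prop :=
  μ.real {ω | ‖star (sys.channel hw k (sys.servingBS k) ω) ⬝ᵥ
          (ctl.F (sys.cluster k) *ᵥ WithLp.ofLp (g ω))‖ ^ 2 ≥
        sys.weight k * γ / sys.power k * (ctl.interferenceApprox k + 1)} ≥
    1 - sys.outage k

/-- `Tr (Θ̄°_n F_n F_n†)` for `n` the cluster of user `k`, where `Θ̄°_n = Θ°_n / λ_n`. -/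
def signalTrace (k : Fin K) : ℝ :=
  ((((1 / sys.lam (sys.cluster k) : ℝ) : ℂ) • sys.corr₀ (sys.cluster k)) *
    (ctl.F (sys.cluster k) * (ctl.F (sys.cluster k))ᴴ)).trace.re

end CellularSystem.SubspaceControl

namespace CellularSystem

variable {M K L N : ℕ} (sys : CellularSystem M K L N)

/-- `Θ̄_{k,n} = (w_k P̄_n / (ℓ λ P_k)) Θ_{k, l_n}`, with `λ` the largest eigenvalue for the cluster
of user `k` and `ℓ` a scalar standing for the gain of the direct link. -/
def crossCorr (l : ℝ) (k : Fin K) (n : Fin N) : Matrix (Fin M) (Fin M) ℂ :=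
  ((sys.weight k * sys.clusterPower n / (l * sys.lam (sys.cluster k) * sys.power k) : ℝ) : ℂ) •
    sys.corr k (sys.bs n)

/-- `c_k(γ) = w_k γ / (ℓ λ P_k) + (1 - √(2 δ_k) / σ_k) (|U| - 1)`, with `U` the cluster of
user `k`. -/
def offset (l : ℝ) (k : Fin K) (γ : ℝ) : ℝ :=
  sys.weight k * γ / (l * sys.lam (sys.cluster k) * sys.power k) +
    (1 - Real.sqrt (2 * sys.delta k) / sys.sigma k) *
      (((sys.users (sys.cluster k)).card : ℝ) - 1)

end CellularSystem

namespace CellularSystem.SubspaceControl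

variable {M K L N : ℕ} {sys : CellularSystem M K L N} (ctl : sys.SubspaceControl)

/-- `∑_{n ∈ B_k} Tr (Θ̄_{k,n} F_n F_n†)`. -/
def leakageTrace (l : ℝ) (k : Fin K) : ℝ :=
  ∑ n ∈ sys.interferers k, (sys.crossCorr l k n * (ctl.F n * (ctl.F n)ᴴ)).trace.re

/-- The pair of deterministic trace inequalities for user `k`, normalized by the gain `l`. -/
def TraceConditions (l : ℝ) (k : Fin K) (γ : ℝ) : Prop :=
  (1 - Real.sqrt (2 * sys.delta k) / sys.sigma k) * ctl.signalTrace k ≥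
      γ * ctl.leakageTrace l k + sys.offset l k γ ∧
    ctl.signalTrace k ≥ sys.sigma k ^ 2 + ((sys.users (sys.cluster k)).card : ℝ) - 1

end CellularSystem.SubspaceControl

end MassiveMIMO

end

/-!
Put `B = Fᴴ Θ^{1/2}` for the channel of user `k` from its serving BS, let `W` be the span of the
effective channels of the other users of its cluster and `C = (1 - P_W) B`, with `P_W` the
orthogonal projection on `W`. Zero forcing makes the received power at least `‖C x‖²` for the
white vector `x ∼ CN(0, I)` of user `k` (`norm_zfProjection_le`), and `x` is independent of `W`, so
`W` may be frozen (`measureReal_mem_le_of_indepFun`; the bad event is open in all the channels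
jointly, hence measurable).

For fixed `W`, unitary invariance of `CN(0, I)` (`map_whiteGaussian`) turns `‖C x‖²` into a sum of
i.i.d. exponential variables weighted by the eigenvalues of `Cᴴ C`. With `Λ = L_k λ` these
eigenvalues lie in `[0, Λ]`, and their sum is at least `Λ (T - (|U| - 1))`, where `T` is the
normalized signal trace, because `B Bᴴ ≤ Λ` and `dim W ≤ |U| - 1`
(`trace_projMatrix_orthogonal_mul_ge`). A Chernoff bound for the lower tail
(`whiteGaussian_quadraticForm_lt`) then shows that the power falls below the fraction
`1 - √(2δ)/σ` of its conditional mean with probability at most `exp (-δ) = ε`, as soon as that mean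
is at least `σ² Λ`: this is the second trace condition, and the first one says that the required
power is at most that fraction of `Λ (T - (|U| - 1))`.

When `L_k ≥ 1`, dropping `L_k` only strengthens the trace conditions if `γ ≥ 0`, while for `γ < 0`
the required power is not positive and the constraint is void.
-/

namespace MassiveMIMO

open MeasureTheory ProbabilityTheory

/-! ### The law `CN(0, I)`: unitary invariance and Laplace transform -/

section WhiteGaussian

variable {ι : Type*} [Fintype ι]

instance : IsProbabilityMeasure stdComplexGaussian :=
  Measure.isProbabilityMeasure_map (by fun_prop)

lemma charFun_stdComplexGaussian (t : ℂ) :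
    charFun stdComplexGaussian t = Complex.exp (-‖t‖ ^ 2 / 4) := by
  rw [charFun_apply, stdComplexGaussian, integral_map (by fun_prop) (by fun_prop)]
  have h (p : ℝ × ℝ) : Complex.exp (inner ℝ ((p.1 : ℂ) + (p.2 : ℂ) * Complex.I) t * Complex.I) =
      Complex.exp (t.re * p.1 * Complex.I) * Complex.exp (t.im * p.2 * Complex.I) := by
    rw [← Complex.exp_add, Complex.inner]
    congr 1
    simp
    ring
  simp_rw [h]
  rw [integral_prod_mul (fun x : ℝ => Complex.exp (t.re * x * Complex.I))
    (fun y : ℝ => Complex.exp (t.im * y * Complex.I)), ← charFun_apply_real,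
    ← charFun_apply_real, charFun_gaussianReal, charFun_gaussianReal, ← Complex.exp_add]
  congr 1
  rw [← Complex.ofReal_pow ‖t‖, ← Complex.normSq_eq_norm_sq, Complex.normSq_apply]
  push_cast
  ring

variable (ι) in
/-- The law `CN(0, I)` of a vector with i.i.d. standard complex Gaussian coordinates, on the
Euclidean space `ℂ^ι`. -/
noncomputable def whiteGaussian : Measure (EuclideanSpace ℂ ι) :=
  (Measure.pi fun _ : ι => stdComplexGaussian).map (WithLp.toLp 2)

instance : IsProbabilityMeasure (whiteGaussian ι) :=
  Measure.isProbabilityMeasure_map (by fun_prop)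

lemma charFun_whiteGaussian (t : EuclideanSpace ℂ ι) :
    charFun (whiteGaussian ι) t = Complex.exp (-‖t‖ ^ 2 / 4) := by
  have := charFun_pi (μ := fun _ : ι => stdComplexGaussian) t
  refine this.trans ?_
  simp_rw [charFun_stdComplexGaussian, ← Complex.exp_sum, ← Complex.ofReal_pow,
    EuclideanSpace.norm_sq_eq]
  simp [Finset.sum_div, neg_div]

/-- The law `CN(0, I)` is unitarily invariant, because its characteristic function depends on the
norm only. -/
lemma map_whiteGaussian (e : EuclideanSpace ℂ ι ≃ₗᵢ[ℂ] EuclideanSpace ℂ ι) :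
    (whiteGaussian ι).map e = whiteGaussian ι := by
  apply Measure.ext_of_charFun
  ext t
  rw [charFun_apply, integral_map (by fun_prop) (by fun_prop)]
  have h (x : EuclideanSpace ℂ ι) : inner ℝ (e x) t = inner ℝ x (e.symm t) := by
    let e' : EuclideanSpace ℂ ι ≃ₗᵢ[ℝ] EuclideanSpace ℂ ι :=
      ⟨e.toLinearEquiv.restrictScalars ℝ, e.norm_map⟩
    have : inner ℝ (e x) (e (e.symm t)) = inner ℝ x (e.symm t) := e'.inner_map_map x (e.symm t)
    rwa [e.apply_symm_apply] at this
  simp_rw [h]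
  rw [← charFun_apply, charFun_whiteGaussian, charFun_whiteGaussian, e.symm.norm_map]

lemma integral_exp_neg_mul_sq_gaussianReal_half {a : ℝ} (ha : 0 ≤ a) :
    ∫ x, Real.exp (-a * x ^ 2) ∂gaussianReal 0 (1 / 2) = (√(1 + a))⁻¹ := by
  rw [integral_gaussianReal_eq_integral_smul (by norm_num)]
  have h (x : ℝ) : gaussianPDFReal 0 (1 / 2) x • Real.exp (-a * x ^ 2) =
      (√Real.pi)⁻¹ * Real.exp (-(1 + a) * x ^ 2) := by
    rw [gaussianPDFReal_def, smul_eq_mul, mul_assoc, ← Real.exp_add]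
    push_cast
    congr 2
    · congr 1; ring
    · ring
  simp_rw [h]
  rw [integral_const_mul, integral_gaussian, Real.sqrt_div Real.pi_pos.le]
  field_simp

lemma integral_exp_neg_mul_normSq_stdComplexGaussian {a : ℝ} (ha : 0 ≤ a) :
    ∫ z, Real.exp (-a * ‖z‖ ^ 2) ∂stdComplexGaussian = (1 + a)⁻¹ := by
  rw [stdComplexGaussian, integral_map (by fun_prop) (by fun_prop)]
  have h (p : ℝ × ℝ) : Real.exp (-a * ‖(p.1 : ℂ) + (p.2 : ℂ) * Complex.I‖ ^ 2) =
      Real.exp (-a * p.1 ^ 2) * Real.exp (-a * p.2 ^ 2) := by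
    rw [← Real.exp_add, ← Complex.normSq_eq_norm_sq, Complex.normSq_add_mul_I]
    ring_nf
  simp_rw [h]
  rw [integral_prod_mul (fun x : ℝ => Real.exp (-a * x ^ 2)) (fun y : ℝ => Real.exp (-a * y ^ 2)),
    integral_exp_neg_mul_sq_gaussianReal_half ha, ← mul_inv,
    Real.mul_self_sqrt (by positivity)]

lemma integral_exp_neg_sum_whiteGaussian {a : ι → ℝ} (ha : ∀ i, 0 ≤ a i) :
    ∫ z, Real.exp (-∑ i, a i * ‖z i‖ ^ 2) ∂whiteGaussian ι = ∏ i, (1 + a i)⁻¹ := by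
  rw [whiteGaussian, integral_map (by fun_prop) (by fun_prop)]
  simp_rw [← Finset.sum_neg_distrib, Real.exp_sum, ← neg_mul]
  rw [integral_fintype_prod_eq_prod (𝕜 := ℝ) (fun i (z : ℂ) => Real.exp (-a i * ‖z‖ ^ 2))]
  exact Finset.prod_congr rfl fun i _ => integral_exp_neg_mul_normSq_stdComplexGaussian (ha i)

/-! ### A lower-tail Chernoff bound -/

/-- `log (1 + x) ≥ x - x² / 2`, in exponential form. -/
lemma inv_one_add_le_exp {x : ℝ} (hx : 0 ≤ x) : (1 + x)⁻¹ ≤ Real.exp (-x + x ^ 2 / 2) := by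
  have h : Real.exp (x - x ^ 2 / 2) ≤ 1 + x := by
    have h1 := Real.le_log_one_add_of_nonneg hx
    rw [← Real.le_log_iff_exp_le (by positivity)]
    refine le_trans ?_ h1
    rw [le_div_iff₀ (by positivity)]
    nlinarith [pow_nonneg hx 3]
  rw [show -x + x ^ 2 / 2 = -(x - x ^ 2 / 2) by ring, Real.exp_neg]
  exact inv_anti₀ (Real.exp_pos _) h

/-- Chernoff bound for the lower tail of a weighted sum of i.i.d. exponential variables with
weights in `[0, Λ]`. -/
lemma whiteGaussian_real_sum_le {d : ι → ℝ} {Λ : ℝ} (hd : ∀ i, 0 ≤ d i) (hdΛ : ∀ i, d i ≤ Λ)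
    {s : ℝ} (hs : 0 ≤ s) (c : ℝ) :
    (whiteGaussian ι).real {z | ∑ i, d i * ‖z i‖ ^ 2 ≤ c} ≤
      Real.exp (s * c - s * ∑ i, d i + s ^ 2 * Λ * (∑ i, d i) / 2) := by
  have hexp (z : EuclideanSpace ℂ ι) : -s * ∑ i, d i * ‖z i‖ ^ 2 =
      -∑ i, (s * d i) * ‖z i‖ ^ 2 := by
    rw [Finset.mul_sum, ← Finset.sum_neg_distrib]
    exact Finset.sum_congr rfl fun i _ => by ring
  have hint : Integrable (fun z : EuclideanSpace ℂ ι => Real.exp (-s * ∑ i, d i * ‖z i‖ ^ 2))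
      (whiteGaussian ι) := by
    refine (integrable_const (1 : ℝ)).mono' (by fun_prop) (Filter.Eventually.of_forall fun z => ?_)
    rw [Real.norm_of_nonneg (Real.exp_nonneg _), Real.exp_le_one_iff, hexp, neg_nonpos]
    exact Finset.sum_nonneg fun i _ => mul_nonneg (mul_nonneg hs (hd i)) (sq_nonneg _)
  refine (measure_le_le_exp_mul_mgf c (neg_nonpos.2 hs) hint).trans ?_
  simp_rw [mgf, hexp]
  rw [integral_exp_neg_sum_whiteGaussian fun i => mul_nonneg hs (hd i)]
  calc Real.exp (- -s * c) * ∏ i, (1 + s * d i)⁻¹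
      ≤ Real.exp (s * c) * ∏ i, Real.exp (-(s * d i) + s ^ 2 * Λ * d i / 2) := by
        rw [neg_neg]
        gcongr with i
        · intro i _
          have := mul_nonneg hs (hd i)
          positivity
        · refine (inv_one_add_le_exp (mul_nonneg hs (hd i))).trans (Real.exp_le_exp.2 ?_)
          have := mul_le_mul_of_nonneg_left (hdΛ i) (mul_nonneg (sq_nonneg s) (hd i))
          nlinarith
    _ = _ := by
        rw [← Real.exp_sum, ← Real.exp_add, Finset.sum_add_distrib, Finset.sum_neg_distrib,
          ← Finset.mul_sum, ← Finset.sum_div, ← Finset.mul_sum]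
        ring_nf

end WhiteGaussian

/-! ### Eigenvalues, projections and traces of complex matrices -/

section Matrices

variable {ι κ : Type*} [Fintype ι] [Fintype κ] [DecidableEq κ]

/-- A Hermitian form is diagonal in the coordinates of an orthonormal eigenbasis. -/
lemma star_dotProduct_mulVec_eq_sum_eigenvalues [DecidableEq ι] {A : Matrix ι ι ℂ} (hA : A.IsHermitian)
    (x : EuclideanSpace ℂ ι) :
    star x.ofLp ⬝ᵥ A *ᵥ x.ofLp =
      ((∑ i, hA.eigenvalues i * ‖hA.eigenvectorBasis.repr x i‖ ^ 2 : ℝ) : ℂ) := by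
  have h1 : star x.ofLp ⬝ᵥ A *ᵥ x.ofLp =
      inner ℂ x (WithLp.toLp 2 (A *ᵥ x.ofLp) : EuclideanSpace ℂ ι) := by
    rw [EuclideanSpace.inner_eq_star_dotProduct, dotProduct_comm]
  rw [h1, ← hA.eigenvectorBasis.sum_inner_mul_inner]
  push_cast
  refine Finset.sum_congr rfl fun i _ => ?_
  have h2 : inner ℂ (hA.eigenvectorBasis i) (WithLp.toLp 2 (A *ᵥ x.ofLp) : EuclideanSpace ℂ ι) =
      (hA.eigenvalues i : ℂ) * inner ℂ (hA.eigenvectorBasis i) x := by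
    rw [EuclideanSpace.inner_eq_star_dotProduct, EuclideanSpace.inner_eq_star_dotProduct,
      dotProduct_comm, dotProduct_comm x.ofLp, Matrix.dotProduct_mulVec]
    have h3 := hA.mulVec_eigenvectorBasis i
    have h4 : star (hA.eigenvectorBasis i).ofLp ᵥ* A =
        star ((hA.eigenvalues i) • (hA.eigenvectorBasis i).ofLp) := by
      rw [← h3, Matrix.star_mulVec, hA.eq]
    rw [h4, star_smul, smul_dotProduct]
    simp
  rw [h2, OrthonormalBasis.repr_apply_apply, ← inner_conj_symm x, mul_left_comm,
    ← Complex.normSq_eq_conj_mul_self, Complex.normSq_eq_norm_sq]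
  push_cast
  rfl

/-- The largest eigenvalue dominates the matrix in the Loewner order. -/
lemma posSemidef_largestEigenvalue_smul_one_sub {M : ℕ} {A : Matrix (Fin M) (Fin M) ℂ}
    (hA : A.IsHermitian) :
    (((largestEigenvalue A hA : ℝ) : ℂ) • (1 : Matrix (Fin M) (Fin M) ℂ) - A).PosSemidef := by
  refine Matrix.PosSemidef.of_dotProduct_mulVec_nonneg
    ((Matrix.isHermitian_one.smul (by simp [isSelfAdjoint_iff])).sub hA) fun x => ?_
  have h := star_dotProduct_mulVec_eq_sum_eigenvalues hA (WithLp.toLp 2 x)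
  have hn : star x ⬝ᵥ x =
      ((∑ i, ‖hA.eigenvectorBasis.repr (WithLp.toLp 2 x) i‖ ^ 2 : ℝ) : ℂ) := by
    rw [← EuclideanSpace.norm_sq_eq, LinearIsometryEquiv.norm_map, dotProduct_comm,
      ← EuclideanSpace.inner_toLp_toLp, inner_self_eq_norm_sq_to_K]
    simp
  simp only at h
  rw [Matrix.sub_mulVec, dotProduct_sub, h, Matrix.smul_mulVec, Matrix.one_mulVec, dotProduct_smul,
    hn, smul_eq_mul, ← Complex.ofReal_mul, ← Complex.ofReal_sub, Complex.zero_le_real, sub_nonneg,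
    Finset.mul_sum]
  gcongr with i
  exact le_ciSup (Set.finite_range hA.eigenvalues).bddAbove i

lemma eigenvalues_le_of_posSemidef_sub [DecidableEq ι] {A : Matrix ι ι ℂ} (hA : A.IsHermitian) {Λ : ℝ}
    (h : ((Λ : ℂ) • (1 : Matrix ι ι ℂ) - A).PosSemidef) (i : ι) : hA.eigenvalues i ≤ Λ := by
  have h1 := h.dotProduct_mulVec_nonneg (hA.eigenvectorBasis i).ofLp
  have hn : star (hA.eigenvectorBasis i).ofLp ⬝ᵥ (hA.eigenvectorBasis i).ofLp = 1 := by
    rw [dotProduct_comm, ← EuclideanSpace.inner_eq_star_dotProduct, inner_self_eq_norm_sq_to_K]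
    simp
  rw [Matrix.sub_mulVec, dotProduct_sub, hA.mulVec_eigenvectorBasis, Matrix.smul_mulVec,
    Matrix.one_mulVec, dotProduct_smul, dotProduct_smul, hn, smul_eq_mul, mul_one,
    Complex.real_smul, mul_one, ← Complex.ofReal_sub, Complex.zero_le_real] at h1
  linarith

/-- The matrix of the orthogonal projection onto a subspace of `ℂ^κ`. -/
noncomputable def projMatrix (W : Submodule ℂ (EuclideanSpace ℂ κ)) : Matrix κ κ ℂ :=
  (Matrix.toEuclideanCLM (n := κ) (𝕜 := ℂ)).symm W.starProjection

lemma projMatrix_mul_self (W : Submodule ℂ (EuclideanSpace ℂ κ)) :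
    projMatrix W * projMatrix W = projMatrix W := by
  rw [projMatrix, ← map_mul, W.isIdempotentElem_starProjection.eq]

lemma conjTranspose_projMatrix (W : Submodule ℂ (EuclideanSpace ℂ κ)) :
    (projMatrix W)ᴴ = projMatrix W := by
  have h := (Matrix.toEuclideanCLM (n := κ) (𝕜 := ℂ)).symm.map_star' W.starProjection
  rw [isStarProjection_starProjection.isSelfAdjoint.star_eq] at h
  exact h.symm

lemma projMatrix_mulVec (W : Submodule ℂ (EuclideanSpace ℂ κ)) (x : κ → ℂ) :
    projMatrix W *ᵥ x = (W.starProjection (WithLp.toLp 2 x)).ofLp := by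
  have := Matrix.ofLp_toEuclideanCLM (projMatrix W) (WithLp.toLp 2 x)
  rw [← this, projMatrix]
  simp

lemma trace_projMatrix (W : Submodule ℂ (EuclideanSpace ℂ κ)) :
    (projMatrix W).trace = (Module.finrank ℂ W : ℂ) := by
  have h1 : LinearMap.IsProj W (W.starProjection : EuclideanSpace ℂ κ →ₗ[ℂ] EuclideanSpace ℂ κ) :=
    ⟨fun x => W.starProjection_apply_mem x, fun x hx => W.starProjection_eq_self_iff.2 hx⟩
  rw [← h1.trace, ← Matrix.trace_toLin_eq (projMatrix W) (EuclideanSpace.basisFun κ ℂ).toBasis]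
  congr 1
  ext x : 1
  change _ = W.starProjection x
  have : W.starProjection = Matrix.toEuclideanCLM (n := κ) (𝕜 := ℂ) (projMatrix W) := by simp [projMatrix]
  rw [this]
  rfl

lemma projMatrix_orthogonal (W : Submodule ℂ (EuclideanSpace ℂ κ)) :
    projMatrix Wᗮ = 1 - projMatrix W := by
  rw [projMatrix, Submodule.starProjection_orthogonal', map_sub, map_one, projMatrix]

/-- Removing the component in `W` from a random vector `B x`, with `B Bᴴ ≤ Λ`, costs at most
`Λ dim W` in mean energy. -/
lemma trace_projMatrix_orthogonal_mul_ge {B : Matrix κ ι ℂ} {Λ : ℝ}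
    (hB : ((Λ : ℂ) • (1 : Matrix κ κ ℂ) - B * Bᴴ).PosSemidef)
    (W : Submodule ℂ (EuclideanSpace ℂ κ)) :
    (B * Bᴴ).trace.re - Λ * Module.finrank ℂ W ≤
      ((projMatrix Wᗮ * B)ᴴ * (projMatrix Wᗮ * B)).trace.re := by
  have h1 : ((projMatrix Wᗮ * B)ᴴ * (projMatrix Wᗮ * B)).trace =
      (B * Bᴴ).trace - (projMatrix W * (B * Bᴴ)).trace := by
    rw [Matrix.conjTranspose_mul, conjTranspose_projMatrix, Matrix.mul_assoc,
      ← Matrix.mul_assoc (projMatrix Wᗮ), projMatrix_mul_self, Matrix.trace_mul_comm,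
      Matrix.mul_assoc, projMatrix_orthogonal, Matrix.sub_mul, Matrix.one_mul, Matrix.trace_sub]
  have h2 := (hB.conjTranspose_mul_mul_same (projMatrix W)).trace_nonneg
  rw [conjTranspose_projMatrix, Matrix.trace_mul_comm, ← Matrix.mul_assoc, projMatrix_mul_self,
    Matrix.mul_sub, Matrix.trace_sub, Matrix.mul_smul, Matrix.mul_one, Matrix.trace_smul,
    trace_projMatrix] at h2
  have h3 := (Complex.le_def.1 h2).1
  simp at h3
  rw [h1, Complex.sub_re]
  linarith

lemma posSemidef_sub_projMatrix_orthogonal_mul [DecidableEq ι] {B : Matrix κ ι ℂ} {Λ : ℝ}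
    (hB : ((Λ : ℂ) • (1 : Matrix ι ι ℂ) - Bᴴ * B).PosSemidef)
    (W : Submodule ℂ (EuclideanSpace ℂ κ)) :
    ((Λ : ℂ) • (1 : Matrix ι ι ℂ) - (projMatrix Wᗮ * B)ᴴ * (projMatrix Wᗮ * B)).PosSemidef := by
  have h := hB.add (Matrix.posSemidef_conjTranspose_mul_self (projMatrix W * B))
  convert h using 1
  have h1 (V : Submodule ℂ (EuclideanSpace ℂ κ)) :
      (projMatrix V * B)ᴴ * (projMatrix V * B) = Bᴴ * (projMatrix V * B) := by
    rw [Matrix.conjTranspose_mul, conjTranspose_projMatrix, Matrix.mul_assoc,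
      ← Matrix.mul_assoc (projMatrix V), projMatrix_mul_self]
  rw [h1, h1, projMatrix_orthogonal, Matrix.sub_mul, Matrix.mul_sub, Matrix.one_mul]
  abel

lemma psdSqrt_mul_self {M : ℕ} {A : Matrix (Fin M) (Fin M) ℂ} (hA : A.PosSemidef) :
    psdSqrt A * psdSqrt A = A := by
  open scoped MatrixOrder in
  exact CFC.sqrt_mul_sqrt_self A hA.nonneg

lemma conjTranspose_psdSqrt {M : ℕ} (A : Matrix (Fin M) (Fin M) ℂ) :
    (psdSqrt A)ᴴ = psdSqrt A := by
  open scoped MatrixOrder in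
  exact (Matrix.nonneg_iff_posSemidef.1 (CFC.sqrt_nonneg A)).isHermitian.eq

/-- For semi-unitary `F` and `Θ ≤ Λ`, the matrix `B = Fᴴ Θ^{1/2}` satisfies `B Bᴴ ≤ Λ`. -/
lemma posSemidef_sub_effMatrix_mul_conjTranspose {M S : ℕ} {Θ : Matrix (Fin M) (Fin M) ℂ}
    (hΘ : Θ.PosSemidef) {Λ : ℝ} (hΛ : ((Λ : ℂ) • (1 : Matrix (Fin M) (Fin M) ℂ) - Θ).PosSemidef)
    {F : Matrix (Fin M) (Fin S) ℂ} (hF : Fᴴ * F = 1) :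
    ((Λ : ℂ) • (1 : Matrix (Fin S) (Fin S) ℂ) -
      (Fᴴ * psdSqrt Θ) * (Fᴴ * psdSqrt Θ)ᴴ).PosSemidef := by
  convert hΛ.conjTranspose_mul_mul_same F using 1
  rw [Matrix.conjTranspose_mul, conjTranspose_psdSqrt, Matrix.conjTranspose_conjTranspose,
    Matrix.mul_assoc, ← Matrix.mul_assoc (psdSqrt Θ), psdSqrt_mul_self hΘ, Matrix.mul_assoc,
    Matrix.sub_mul, Matrix.mul_sub, Matrix.smul_mul, Matrix.mul_smul, Matrix.one_mul, hF]

/-- For semi-unitary `F` and `Θ ≤ Λ`, the matrix `B = Fᴴ Θ^{1/2}` satisfies `Bᴴ B ≤ Λ`. -/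
lemma posSemidef_sub_conjTranspose_mul_effMatrix {M S : ℕ} {Θ : Matrix (Fin M) (Fin M) ℂ}
    (hΘ : Θ.PosSemidef) {Λ : ℝ} (hΛ : ((Λ : ℂ) • (1 : Matrix (Fin M) (Fin M) ℂ) - Θ).PosSemidef)
    {F : Matrix (Fin M) (Fin S) ℂ} (hF : Fᴴ * F = 1) :
    ((Λ : ℂ) • (1 : Matrix (Fin M) (Fin M) ℂ) -
      (Fᴴ * psdSqrt Θ)ᴴ * (Fᴴ * psdSqrt Θ)).PosSemidef := by
  -- `(1 - F Fᴴ) Θ^{1/2}` collects the energy lost outside the range of `F`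
  convert hΛ.add (Matrix.posSemidef_conjTranspose_mul_self ((1 - F * Fᴴ) * psdSqrt Θ)) using 1
  have h1 : (1 - F * Fᴴ) * (1 - F * Fᴴ) = 1 - F * Fᴴ := by
    have : F * Fᴴ * (F * Fᴴ) = F * Fᴴ := by
      rw [Matrix.mul_assoc, ← Matrix.mul_assoc Fᴴ, hF, Matrix.one_mul]
    rw [Matrix.sub_mul, Matrix.mul_sub (F * Fᴴ), this]
    simp
  have h2 : (1 - F * Fᴴ)ᴴ = 1 - F * Fᴴ := by simp
  rw [Matrix.conjTranspose_mul, Matrix.conjTranspose_mul, h2, conjTranspose_psdSqrt,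
    Matrix.conjTranspose_conjTranspose, Matrix.mul_assoc _ (1 - F * Fᴴ),
    ← Matrix.mul_assoc (1 - F * Fᴴ), h1, Matrix.sub_mul, Matrix.mul_sub, Matrix.one_mul,
    psdSqrt_mul_self hΘ, Matrix.mul_assoc, ← Matrix.mul_assoc F]
  abel

end Matrices

/-! ### Lower tail of complex Gaussian quadratic forms -/

lemma inner_self_eq_ofReal_norm_sq {E : Type*} [NormedAddCommGroup E] [InnerProductSpace ℂ E]
    (v : E) : inner ℂ v v = ((‖v‖ ^ 2 : ℝ) : ℂ) := by
  rw [inner_self_eq_norm_sq_to_K]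
  simp

/-- Lower tail of a complex Gaussian quadratic form with spectrum in `[0, Λ]`: if
`σ² Λ ≤ tr (Cᴴ C)` and `q ≤ (1 - √(2δ)/σ) tr (Cᴴ C)`, then `‖C x‖² < q` has probability at most
`exp (-δ)`. -/
lemma whiteGaussian_quadraticForm_lt {M S : ℕ} {C : Matrix (Fin S) (Fin M) ℂ} {Λ δ σ q : ℝ}
    (hΛ : 0 < Λ) (hC : ((Λ : ℂ) • (1 : Matrix (Fin M) (Fin M) ℂ) - Cᴴ * C).PosSemidef)
    (hδ : 0 ≤ δ) (hσ : 0 < σ) (htr : σ ^ 2 * Λ ≤ (Cᴴ * C).trace.re)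
    (hq : q ≤ (1 - √(2 * δ) / σ) * (Cᴴ * C).trace.re) :
    (whiteGaussian (Fin M)).real {x | ‖(WithLp.toLp 2 (C *ᵥ x.ofLp) :
      EuclideanSpace ℂ (Fin S))‖ ^ 2 < q} ≤ Real.exp (-δ) := by
  have hA : (Cᴴ * C).PosSemidef := Matrix.posSemidef_conjTranspose_mul_self C
  set d := hA.isHermitian.eigenvalues
  set e := hA.isHermitian.eigenvectorBasis.repr
  have hquad (x : EuclideanSpace ℂ (Fin M)) : ‖(WithLp.toLp 2 (C *ᵥ x.ofLp) :
      EuclideanSpace ℂ (Fin S))‖ ^ 2 = ∑ i, d i * ‖e x i‖ ^ 2 := by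
    have h := star_dotProduct_mulVec_eq_sum_eigenvalues hA.isHermitian x
    rw [← Matrix.mulVec_mulVec, Matrix.dotProduct_mulVec, ← Matrix.star_mulVec,
      dotProduct_comm, ← EuclideanSpace.inner_toLp_toLp, inner_self_eq_ofReal_norm_sq] at h
    exact Complex.ofReal_injective h
  have htrace : (Cᴴ * C).trace.re = ∑ i, d i := by
    rw [hA.isHermitian.trace_eq_sum_eigenvalues]
    simp [d]
  rw [htrace] at htr hq
  set τ := ∑ i, d i
  set r := √(2 * δ) / σ with hr
  have hr0 : 0 ≤ r := by positivity
  have hrσ : r ^ 2 * σ ^ 2 = 2 * δ := by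
    rw [hr, div_pow, Real.sq_sqrt (by positivity)]
    field_simp
  calc (whiteGaussian (Fin M)).real {x | ‖(WithLp.toLp 2 (C *ᵥ x.ofLp) :
        EuclideanSpace ℂ (Fin S))‖ ^ 2 < q}
      ≤ (whiteGaussian (Fin M)).real (e ⁻¹' {z | ∑ i, d i * ‖z i‖ ^ 2 ≤ q}) := by
        refine measureReal_mono fun x hx => ?_
        have hx' : ‖(WithLp.toLp 2 (C *ᵥ x.ofLp) : EuclideanSpace ℂ (Fin S))‖ ^ 2 < q := hx
        rw [hquad] at hx'
        exact hx'.le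
    _ = (whiteGaussian (Fin M)).real {z | ∑ i, d i * ‖z i‖ ^ 2 ≤ q} := by
        rw [← map_measureReal_apply (by fun_prop) (measurableSet_le (by fun_prop) (by fun_prop)),
          map_whiteGaussian e]
    -- `s = √(2δ) / (σ Λ)` minimizes the exponent when `q = (1 - √(2δ) / σ) τ`
    _ ≤ Real.exp (r / Λ * q - r / Λ * τ + (r / Λ) ^ 2 * Λ * τ / 2) :=
        whiteGaussian_real_sum_le hA.eigenvalues_nonneg
          (eigenvalues_le_of_posSemidef_sub hA.isHermitian hC) (by positivity) q
    _ ≤ Real.exp (-δ) := by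
        refine Real.exp_le_exp.2 ?_
        have h1 : r / Λ * q ≤ r / Λ * ((1 - r) * τ) := by gcongr
        have h2 : 2 * δ ≤ r ^ 2 * (τ / Λ) := by
          rw [← hrσ]
          gcongr
          rwa [le_div_iff₀ hΛ]
        have h3 : r / Λ * ((1 - r) * τ) - r / Λ * τ + (r / Λ) ^ 2 * Λ * τ / 2 =
            -(r ^ 2 * (τ / Λ)) / 2 := by
          field_simp
          ring
        linarith

/-! ### Conditioning and projections on random subspaces -/

/-- Conditioning on `Y`: if for every fixed `y` the event `D` has probability at most `ε` under the
law of `X`, then the same holds for independent `X` and `Y`. -/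
lemma measureReal_mem_le_of_indepFun {Ω α β : Type*} [MeasurableSpace Ω] [MeasurableSpace α]
    [MeasurableSpace β] {μ : Measure Ω} [IsProbabilityMeasure μ] {X : Ω → α} {Y : Ω → β}
    (hX : Measurable X) (hY : Measurable Y) (h : IndepFun X Y μ) {D : Set (α × β)}
    (hD : MeasurableSet D) {ε : ℝ} (hε : ∀ y, (μ.map X).real {x | (x, y) ∈ D} ≤ ε) :
    μ.real {ω | (X ω, Y ω) ∈ D} ≤ ε := by
  have := Measure.isProbabilityMeasure_map (μ := μ) hX.aemeasurable
  have := Measure.isProbabilityMeasure_map (μ := μ) hY.aemeasurable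
  have h0 : 0 ≤ ε := measureReal_nonneg.trans (hε (Y (nonempty_of_isProbabilityMeasure μ).some))
  have h1 : μ {ω | (X ω, Y ω) ∈ D} = ((μ.map X).prod (μ.map Y)) D := by
    rw [← (indepFun_iff_map_prod_eq_prod_map_map hX.aemeasurable hY.aemeasurable).1 h,
      Measure.map_apply (hX.prodMk hY) hD]
    rfl
  refine ENNReal.toReal_le_of_le_ofReal h0 ?_
  rw [h1, Measure.prod_apply_symm hD]
  calc ∫⁻ y, (μ.map X) ((fun x => (x, y)) ⁻¹' D) ∂μ.map Y
      ≤ ∫⁻ _, ENNReal.ofReal ε ∂μ.map Y := by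
        refine lintegral_mono fun y => ?_
        rw [← ENNReal.ofReal_toReal (measure_ne_top (μ.map X) _)]
        exact ENNReal.ofReal_le_ofReal (hε y)
    _ = ENNReal.ofReal ε := by simp

/-- The distance to the span of a family is below `q` iff some linear combination comes that
close. -/
lemma norm_sq_starProjection_orthogonal_span_lt_iff {J E : Type*} [Fintype J]
    [NormedAddCommGroup E] [InnerProductSpace ℂ E] [FiniteDimensional ℂ E] (u : J → E) (v : E)
    (q : ℝ) :
    ‖(Submodule.span ℂ (Set.range u))ᗮ.starProjection v‖ ^ 2 < q ↔
      ∃ c : J → ℂ, ‖v - ∑ j, c j • u j‖ ^ 2 < q := by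
  set W := Submodule.span ℂ (Set.range u)
  have hv : Wᗮ.starProjection v = v - W.starProjection v := by
    rw [Submodule.starProjection_orthogonal']
    simp
  constructor
  · intro h
    obtain ⟨c, hc⟩ := (Submodule.mem_span_range_iff_exists_fun ℂ).1 (W.starProjection_apply_mem v)
    exact ⟨c, by rwa [hc, ← hv]⟩
  · rintro ⟨c, hc⟩
    refine lt_of_le_of_lt ?_ hc
    gcongr
    have hmem : ∑ j, c j • u j ∈ W := (Submodule.mem_span_range_iff_exists_fun ℂ).2 ⟨c, rfl⟩
    have h0 : Wᗮ.starProjection (∑ j, c j • u j) = 0 := by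
      rw [Submodule.starProjection_orthogonal', sub_apply,
        W.starProjection_eq_self_iff.2 hmem]
      simp
    calc ‖Wᗮ.starProjection v‖ = ‖Wᗮ.starProjection (v - ∑ j, c j • u j)‖ := by
          rw [map_sub, h0, sub_zero]
      _ ≤ _ := Wᗮ.norm_starProjection_apply_le _

/-- If `g` is the normalized projection of `v` on `V`, then `⟪v, g⟫` has at least the modulus of
that projection (with equality unless the projection vanishes). -/
lemma norm_starProjection_le_norm_inner {E : Type*} [NormedAddCommGroup E] [InnerProductSpace ℂ E]
    (V : Submodule ℂ E) [V.HasOrthogonalProjection] {v g : E}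
    (hg : ((‖V.starProjection v‖ : ℝ) : ℂ) • g = V.starProjection v) :
    ‖V.starProjection v‖ ≤ ‖inner ℂ v g‖ := by
  rcases (norm_nonneg (V.starProjection v)).eq_or_lt with h | h
  · rw [← h]
    exact norm_nonneg _
  refine le_of_mul_le_mul_left ?_ h
  have h1 : ((‖V.starProjection v‖ : ℝ) : ℂ) * inner ℂ v g =
      ((‖V.starProjection v‖ ^ 2 : ℝ) : ℂ) := by
    rw [← inner_smul_right, hg, ← inner_self_eq_ofReal_norm_sq,
      V.inner_starProjection_left_eq_right, ← ContinuousLinearMap.comp_apply,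
      ← ContinuousLinearMap.mul_def, V.isIdempotentElem_starProjection.eq]
  have h2 := congrArg norm h1
  rw [norm_mul, Complex.norm_real, Complex.norm_real, norm_norm, norm_pow, norm_norm, sq] at h2
  exact h2.ge

/-! ### The zero-forcing gain in the cellular system -/

variable {M K L N : ℕ} (sys : CellularSystem M K L N)

lemma IsWhiteGaussian.map_eq_whiteGaussian {Ω : Type*} [MeasurableSpace Ω] {μ : Measure Ω}
    {hw : Fin K → Fin L → Fin M → Ω → ℂ} (h : IsWhiteGaussian μ hw) (k : Fin K) (l : Fin L) :
    μ.map (fun ω => (WithLp.toLp 2 fun i => hw k l i ω : EuclideanSpace ℂ (Fin M))) =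
      whiteGaussian (Fin M) := by
  have h1 : iIndepFun (fun i : Fin M => hw k l i) μ :=
    h.indep.precomp (g := fun i => (k, l, i)) fun i j hij => by simpa using hij
  have h2 := h1.map_fun_eq_pi_map fun i => (h.measurable k l i).aemeasurable
  simp_rw [h.law] at h2
  rw [whiteGaussian, ← h2, Measure.map_map (by fun_prop)
    (measurable_pi_lambda _ fun i => h.measurable k l i)]
  rfl

/-- The white vector of a user is independent of those of all other users. -/
lemma IsWhiteGaussian.indepFun {Ω : Type*} [MeasurableSpace Ω] {μ : Measure Ω}
    {hw : Fin K → Fin L → Fin M → Ω → ℂ} (h : IsWhiteGaussian μ hw) (k : Fin K) (l : Fin L)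
    {J : Type*} (f : J → Fin K) (hf : ∀ j, f j ≠ k) :
    IndepFun (fun ω => (WithLp.toLp 2 fun i => hw k l i ω : EuclideanSpace ℂ (Fin M)))
      (fun ω (j : J) (i : Fin M) => hw (f j) l i ω) μ := by
  classical
  let S : Finset (Fin K × Fin L × Fin M) := Finset.univ.filter fun a => a.1 = k
  let T : Finset (Fin K × Fin L × Fin M) := Finset.univ.filter fun a => a.1 ≠ k
  have hST : Disjoint S T := Finset.disjoint_filter_filter_not _ _ _
  have h1 := h.indep.indepFun_finset S T hST fun a => h.measurable a.1 a.2.1 a.2.2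
  let φ (x : S → ℂ) : EuclideanSpace ℂ (Fin M) :=
    WithLp.toLp 2 fun i => x ⟨(k, l, i), by simp [S]⟩
  let ψ (y : T → ℂ) (j : J) (i : Fin M) : ℂ := y ⟨(f j, l, i), by simp [T, hf]⟩
  have hφ : Measurable φ := by fun_prop
  have hψ : Measurable ψ := by fun_prop
  exact h1.comp hφ hψ

namespace CellularSystem

lemma lam_pos (n : Fin N) (hM : 0 < M) : 0 < sys.lam n := by
  have : Nonempty (Fin M) := ⟨⟨0, hM⟩⟩
  have hA := sys.corr₀_psd n
  by_contra! h
  have h1 : (sys.corr₀ n).trace = 0 := by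
    rw [hA.isHermitian.trace_eq_sum_eigenvalues]
    refine Finset.sum_eq_zero fun i _ => ?_
    have h2 : hA.isHermitian.eigenvalues i ≤ sys.lam n :=
      le_ciSup (Set.finite_range hA.isHermitian.eigenvalues).bddAbove i
    rw [le_antisymm (h2.trans h) (hA.eigenvalues_nonneg i)]
    simp
  rw [sys.corr₀_trace] at h1
  simp [hM.ne'] at h1

lemma clusterPower_nonneg (n : Fin N) : 0 ≤ sys.clusterPower n :=
  Finset.sum_nonneg fun k _ => sys.power_nonneg k

lemma delta_nonneg (k : Fin K) : 0 ≤ sys.delta k :=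
  Real.log_nonneg (one_le_one_div (sys.outage_pos k) (sys.outage_lt_one k).le)

lemma exp_neg_delta (k : Fin K) : Real.exp (-sys.delta k) = sys.outage k := by
  rw [delta, one_div, Real.log_inv, neg_neg, Real.exp_log (sys.outage_pos k)]

lemma sigma_pos (k : Fin K) : 0 < sys.sigma k := by
  have := sys.delta_nonneg k
  rw [sigma]
  positivity

lemma sqrt_delta_div_sigma_le_one (k : Fin K) : √(2 * sys.delta k) / sys.sigma k ≤ 1 := by
  rw [div_le_one (sys.sigma_pos k), sigma]
  have : √(2 * sys.delta k) ≤ √(2 * sys.delta k + 4) := Real.sqrt_le_sqrt (by linarith)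
  linarith

namespace SubspaceControl

variable {sys} (ctl : sys.SubspaceControl)

lemma trace_corr_nonneg (k : Fin K) (n : Fin N) :
    0 ≤ ((ctl.F n)ᴴ * sys.corr k (sys.bs n) * ctl.F n).trace.re :=
  (Complex.le_def.1 ((sys.corr_psd k (sys.bs n)).conjTranspose_mul_mul_same
    (ctl.F n)).trace_nonneg).1

lemma interferenceApprox_nonneg (k : Fin K) : 0 ≤ ctl.interferenceApprox k :=
  Finset.sum_nonneg fun n _ => mul_nonneg (sys.clusterPower_nonneg n) (ctl.trace_corr_nonneg k n)

lemma leakageTrace_eq (l : ℝ) (k : Fin K) :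
    ctl.leakageTrace l k =
      sys.weight k / (l * sys.lam (sys.cluster k) * sys.power k) * ctl.interferenceApprox k := by
  rw [leakageTrace, interferenceApprox, Finset.mul_sum]
  refine Finset.sum_congr rfl fun n _ => ?_
  rw [CellularSystem.crossCorr, Matrix.smul_mul, Matrix.trace_smul, smul_eq_mul,
    Complex.re_ofReal_mul, ← Matrix.mul_assoc, Matrix.trace_mul_comm, ← Matrix.mul_assoc]
  ring

/-- The mean energy of the effective channel before zero forcing. -/
lemma trace_effMatrix_mul_conjTranspose (k : Fin K) (hlam : 0 < sys.lam (sys.cluster k)) :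
    (((ctl.F (sys.cluster k))ᴴ * psdSqrt (sys.corr k (sys.servingBS k))) *
      ((ctl.F (sys.cluster k))ᴴ * psdSqrt (sys.corr k (sys.servingBS k)))ᴴ).trace.re =
    sys.pathLoss k * sys.lam (sys.cluster k) * ctl.signalTrace k := by
  set F := ctl.F (sys.cluster k)
  rw [Matrix.conjTranspose_mul, conjTranspose_psdSqrt, Matrix.conjTranspose_conjTranspose,
    Matrix.mul_assoc, ← Matrix.mul_assoc (psdSqrt _), psdSqrt_mul_self (sys.corr_psd _ _),
    Matrix.trace_mul_comm, Matrix.mul_assoc, CellularSystem.servingBS, sys.corr_serving,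
    Matrix.smul_mul, Matrix.trace_smul, smul_eq_mul, Complex.re_ofReal_mul, signalTrace,
    Matrix.smul_mul, Matrix.trace_smul, smul_eq_mul, Complex.re_ofReal_mul]
  field_simp
  rfl

/-- The zero-forcing gain falls below `q` with probability at most `ε_k`, provided that `q` is at
most the guaranteed fraction of its mean. -/
lemma measureReal_zfProjection_lt_le {Ω : Type*} [MeasurableSpace Ω] {μ : Measure Ω}
    [IsProbabilityMeasure μ] {hw : Fin K → Fin L → Fin M → Ω → ℂ} (hhw : IsWhiteGaussian μ hw)
    (k : Fin K) (hlam : 0 < sys.lam (sys.cluster k))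
    (htr : sys.sigma k ^ 2 ≤ ctl.signalTrace k - ((sys.users (sys.cluster k)).card - 1))
    {q : ℝ} (hq : q ≤ (1 - √(2 * sys.delta k) / sys.sigma k) *
      (sys.pathLoss k * sys.lam (sys.cluster k) *
        (ctl.signalTrace k - ((sys.users (sys.cluster k)).card - 1)))) :
    μ.real {ω | ‖ctl.zfProjection hw k ω‖ ^ 2 < q} ≤ sys.outage k := by
  classical
  set b := sys.servingBS k
  set Λ := sys.pathLoss k * sys.lam (sys.cluster k) with hΛdef
  have hΛ : 0 < Λ := mul_pos (sys.pathLoss_pos k) hlam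
  let J := {j : Fin K // sys.cluster j = sys.cluster k ∧ j ≠ k}
  have hJ : (Fintype.card J : ℝ) = (sys.users (sys.cluster k)).card - 1 := by
    have hk : k ∈ sys.users (sys.cluster k) := by simp [CellularSystem.users]
    rw [Fintype.card_subtype, ← Nat.cast_pred (Finset.card_pos.2 ⟨k, hk⟩),
      ← Finset.card_erase_of_mem hk]
    congr 2
    ext j
    simp [CellularSystem.users, and_comm]
  let B (j : Fin K) := (ctl.F (sys.cluster k))ᴴ * psdSqrt (sys.corr j b)
  let X (ω : Ω) : EuclideanSpace ℂ (Fin M) := WithLp.toLp 2 fun i => hw k b i ω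
  let Y (ω : Ω) (j : J) (i : Fin M) : ℂ := hw j b i ω
  let u (y : J → Fin M → ℂ) (j : J) : EuclideanSpace ℂ (Fin (ctl.S (sys.cluster k))) :=
    WithLp.toLp 2 (B j *ᵥ y j)
  let v (x : EuclideanSpace ℂ (Fin M)) : EuclideanSpace ℂ (Fin (ctl.S (sys.cluster k))) :=
    WithLp.toLp 2 (B k *ᵥ x.ofLp)
  let W (y : J → Fin M → ℂ) := Submodule.span ℂ (Set.range (u y))
  let D : Set (EuclideanSpace ℂ (Fin M) × (J → Fin M → ℂ)) :=
    {p | ‖(W p.2)ᗮ.starProjection (v p.1)‖ ^ 2 < q}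
  -- the distance to a span is upper semicontinuous in the spanning vectors
  have hD : IsOpen D := by
    have : D = ⋃ c : J → ℂ, {p | ‖v p.1 - ∑ j, c j • u p.2 j‖ ^ 2 < q} := by
      ext p
      simp only [Set.mem_iUnion]
      exact norm_sq_starProjection_orthogonal_span_lt_iff _ _ _
    rw [this]
    refine isOpen_iUnion fun c => isOpen_lt ?_ continuous_const
    have hv : Continuous v := by fun_prop
    have hu : Continuous u := by fun_prop
    fun_prop
  have hset : {ω | ‖ctl.zfProjection hw k ω‖ ^ 2 < q} = {ω | (X ω, Y ω) ∈ D} := by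
    ext ω
    have h1 (j : Fin K) (x : Fin M → ℂ) (hx : x = fun i => hw j b i ω) :
        ctl.effChannel hw (sys.cluster k) j ω = WithLp.toLp 2 (B j *ᵥ x) := by
      rw [hx, ← Matrix.mulVec_mulVec]
      rfl
    have h2 : (fun j => ctl.effChannel hw (sys.cluster k) j ω) ''
        {j | sys.cluster j = sys.cluster k ∧ j ≠ k} = Set.range (u (Y ω)) := by
      rw [Set.image_eq_range]
      congr 1
      ext1 j
      exact h1 j _ rfl
    simp only [Set.mem_ofPred_eq, zfProjection, D, W]
    simp only [h2, h1 k _ rfl, v, X]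
  rw [hset]
  refine measureReal_mem_le_of_indepFun (by
      have := hhw.measurable
      fun_prop) (by
      have := hhw.measurable
      fun_prop) (hhw.indepFun k b _ fun j => j.2.2) hD.measurableSet fun y => ?_
  rw [hhw.map_eq_whiteGaussian]
  have hle : ((Λ : ℂ) • (1 : Matrix (Fin M) (Fin M) ℂ) - sys.corr k b).PosSemidef := by
    have h := (posSemidef_largestEigenvalue_smul_one_sub
      (sys.corr₀_psd (sys.cluster k)).isHermitian).smul
      (Complex.zero_le_real.2 (sys.pathLoss_pos k).le)
    rw [smul_sub, smul_smul, ← Complex.ofReal_mul, ← sys.corr_serving] at h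
    exact h
  have hF := ctl.semiunitary (sys.cluster k)
  have h1 := posSemidef_sub_projMatrix_orthogonal_mul
    (posSemidef_sub_conjTranspose_mul_effMatrix (sys.corr_psd k b) hle hF) (W y)
  have h2 := trace_projMatrix_orthogonal_mul_ge
    (posSemidef_sub_effMatrix_mul_conjTranspose (sys.corr_psd k b) hle hF) (W y)
  rw [ctl.trace_effMatrix_mul_conjTranspose k hlam, ← hΛdef] at h2
  have h3 : (Module.finrank ℂ (W y) : ℝ) ≤ (sys.users (sys.cluster k)).card - 1 := by
    rw [← hJ]
    exact_mod_cast finrank_range_le_card (u y)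
  have h4 : Λ * (ctl.signalTrace k - ((sys.users (sys.cluster k)).card - 1)) ≤
      ((projMatrix (W y)ᗮ * B k)ᴴ * (projMatrix (W y)ᗮ * B k)).trace.re := by
    refine le_trans ?_ h2
    rw [mul_sub]
    gcongr
  have h5 := whiteGaussian_quadraticForm_lt hΛ h1 (sys.delta_nonneg k) (sys.sigma_pos k)
    (q := q) (le_trans (by rw [mul_comm]; gcongr) h4)
    (hq.trans (mul_le_mul_of_nonneg_left h4
      (sub_nonneg.2 (sys.sqrt_delta_div_sigma_le_one k))))
  rw [sys.exp_neg_delta] at h5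
  refine le_of_eq_of_le ?_ h5
  congr 1
  ext x
  simp only [Set.mem_ofPred_eq, D, v]
  rw [← Matrix.mulVec_mulVec _ (projMatrix _), projMatrix_mulVec]

/-- The received amplitude of a zero-forcing precoder is at least the norm of the projected
channel. -/
lemma norm_zfProjection_le {Ω : Type*} [MeasurableSpace Ω] {hw : Fin K → Fin L → Fin M → Ω → ℂ}
    {k : Fin K} {g : Ω → EuclideanSpace ℂ (Fin (ctl.S (sys.cluster k)))}
    (hg : ctl.IsZFPrecoder hw k g) (ω : Ω) :
    ‖ctl.zfProjection hw k ω‖ ≤ ‖star (sys.channel hw k (sys.servingBS k) ω) ⬝ᵥ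
      (ctl.F (sys.cluster k) *ᵥ WithLp.ofLp (g ω))‖ := by
  have h := norm_starProjection_le_norm_inner _ (hg.proj_eq ω)
  refine h.trans_eq (congrArg norm ?_)
  rw [effChannel, EuclideanSpace.inner_eq_star_dotProduct, dotProduct_comm,
    Matrix.star_mulVec, Matrix.conjTranspose_conjTranspose, Matrix.dotProduct_mulVec]
  rfl

lemma chanceConstraint_of_traceConditions {Ω : Type*} [MeasurableSpace Ω] {μ : Measure Ω}
    [IsProbabilityMeasure μ] {hw : Fin K → Fin L → Fin M → Ω → ℂ} (hhw : IsWhiteGaussian μ hw)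
    {k : Fin K} (hP : 0 < sys.power k) (hlam : 0 < sys.lam (sys.cluster k))
    {g : Ω → EuclideanSpace ℂ (Fin (ctl.S (sys.cluster k)))} (hg : ctl.IsZFPrecoder hw k g)
    {γ : ℝ} (h : ctl.TraceConditions (sys.pathLoss k) k γ) : ctl.ChanceConstraint μ hw k g γ := by
  obtain ⟨hA, hB⟩ := h
  set q := sys.weight k * γ / sys.power k * (ctl.interferenceApprox k + 1) with hqdef
  have hL := sys.pathLoss_pos k
  have hq : q ≤ (1 - √(2 * sys.delta k) / sys.sigma k) *
      (sys.pathLoss k * sys.lam (sys.cluster k) *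
        (ctl.signalTrace k - ((sys.users (sys.cluster k)).card - 1))) := by
    rw [leakageTrace_eq, CellularSystem.offset] at hA
    have h1 : q = sys.pathLoss k * sys.lam (sys.cluster k) *
        (γ * (sys.weight k / (sys.pathLoss k * sys.lam (sys.cluster k) * sys.power k) *
          ctl.interferenceApprox k) +
        sys.weight k * γ / (sys.pathLoss k * sys.lam (sys.cluster k) * sys.power k)) := by
      rw [hqdef]
      field_simp
    rw [mul_left_comm, h1]
    exact mul_le_mul_of_nonneg_left (by linarith) (by positivity)
  have hbad := ctl.measureReal_zfProjection_lt_le hhw k hlam (by linarith) hq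
  -- subadditivity suffices here, so neither event has to be measurable
  have huniv : (1 : ℝ) ≤ μ.real {ω | ‖ctl.zfProjection hw k ω‖ ^ 2 < q}ᶜ +
      μ.real {ω | ‖ctl.zfProjection hw k ω‖ ^ 2 < q} := by
    rw [← probReal_univ (μ := μ), ← Set.compl_union_self]
    exact measureReal_union_le _ _
  have hmono : μ.real {ω | ‖ctl.zfProjection hw k ω‖ ^ 2 < q}ᶜ ≤
      μ.real {ω | ‖star (sys.channel hw k (sys.servingBS k) ω) ⬝ᵥ
        (ctl.F (sys.cluster k) *ᵥ WithLp.ofLp (g ω))‖ ^ 2 ≥ q} := by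
    refine measureReal_mono fun ω hω => ?_
    have hω' : q ≤ ‖ctl.zfProjection hw k ω‖ ^ 2 := not_lt.1 hω
    refine hω'.trans ?_
    gcongr
    exact ctl.norm_zfProjection_le hg ω
  rw [ChanceConstraint]
  linarith

/-- For a negative QoS level the chance constraint is void. -/
lemma chanceConstraint_of_neg {Ω : Type*} [MeasurableSpace Ω] {μ : Measure Ω}
    [IsProbabilityMeasure μ] (hw : Fin K → Fin L → Fin M → Ω → ℂ) {k : Fin K}
    (hP : 0 < sys.power k) (g : Ω → EuclideanSpace ℂ (Fin (ctl.S (sys.cluster k)))) {γ : ℝ}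
    (hγ : γ < 0) : ctl.ChanceConstraint μ hw k g γ := by
  have hq : sys.weight k * γ / sys.power k * (ctl.interferenceApprox k + 1) ≤ 0 :=
    mul_nonpos_of_nonpos_of_nonneg
      (div_nonpos_of_nonpos_of_nonneg
        (mul_nonpos_of_nonneg_of_nonpos (sys.weight_pos k).le hγ.le) hP.le)
      (by linarith [ctl.interferenceApprox_nonneg k])
  have huniv : {ω | ‖star (sys.channel hw k (sys.servingBS k) ω) ⬝ᵥ
      (ctl.F (sys.cluster k) *ᵥ WithLp.ofLp (g ω))‖ ^ 2 ≥
        sys.weight k * γ / sys.power k * (ctl.interferenceApprox k + 1)} = Set.univ :=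
    Set.eq_univ_of_forall fun ω => hq.trans (sq_nonneg _)
  rw [ChanceConstraint, huniv, probReal_univ]
  linarith [sys.outage_pos k]

lemma TraceConditions.mono {l l' : ℝ} {k : Fin K} {γ : ℝ} (hP : 0 < sys.power k)
    (hlam : 0 < sys.lam (sys.cluster k)) (hγ : 0 ≤ γ) (hl : 0 < l) (hll' : l ≤ l')
    (h : ctl.TraceConditions l k γ) : ctl.TraceConditions l' k γ := by
  obtain ⟨hA, hB⟩ := h
  refine ⟨?_, hB⟩
  rw [leakageTrace_eq, CellularSystem.offset] at hA ⊢
  refine le_trans ?_ hA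
  have hw := sys.weight_pos k
  have hI := ctl.interferenceApprox_nonneg k
  gcongr

end SubspaceControl

end CellularSystem

end MassiveMIMO

open MeasureTheory MassiveMIMO in
theorem theorem2 {M K L N : ℕ} (sys : CellularSystem M K L N) (ctl : sys.SubspaceControl)
    {Ω : Type*} [MeasurableSpace Ω] (μ : Measure Ω) [IsProbabilityMeasure μ]
    (hw : Fin K → Fin L → Fin M → Ω → ℂ) (hhw : IsWhiteGaussian μ hw)
    (k : Fin K) (hP : 0 < sys.power k)
    (g : Ω → EuclideanSpace ℂ (Fin (ctl.S (sys.cluster k)))) (hg : ctl.IsZFPrecoder hw k g)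
    (γ : ℝ) :
    (ctl.TraceConditions (sys.pathLoss k) k γ → ctl.ChanceConstraint μ hw k g γ) ∧
    (1 ≤ sys.pathLoss k → ctl.TraceConditions 1 k γ → ctl.ChanceConstraint μ hw k g γ) := by
  -- `1 ≤ |U| ≤ S ≤ M`, since `k` itself lies in its cluster
  have hM : 0 < M :=
    (Finset.card_pos.2 ⟨k, by simp [CellularSystem.users]⟩).trans_le
      ((ctl.card_le_S (sys.cluster k)).trans (ctl.S_le _))
  have hlam := sys.lam_pos (sys.cluster k) hM
  refine ⟨ctl.chanceConstraint_of_traceConditions hhw hP hlam hg, fun hL h => ?_⟩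
  rcases lt_or_ge γ 0 with hγ | hγ
  · exact ctl.chanceConstraint_of_neg hw hP g hγ
  · exact ctl.chanceConstraint_of_traceConditions hhw hP hlam hg
      (h.mono ctl hP hlam hγ one_pos hL)
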